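/- **Setting.** Write each quaternion uniquely as $q=z+wj$ with $z,w\in\mathbb C=\mathbb R+i\mathbb R$. Let $\Omega\subseteq\mathbb H$ be a symmetric slice domain (for instance $\Omega=\mathbb H$), let $V=\{v\in\Omega\cap\mathbb C:\operatorname{Im}v>0\}$, and let $f(q)=\sum_{m=0}^n q^m a_m$ ($a_m\in\mathbb H$) be a slice-regular polynomial with $a_m\neq0$ for some $m\ge1$. Put $S_f=\operatorname{span}_{\mathbb R}\{a_1,\dots,a_n\}$ and $r=\dim_{\mathbb R}S_f$. Write $f|_{\Omega\cap\mathbb C}=g+hj$ with $g,h$ complex valued, and $\hat g(v)=\overline{g(\bar v)}$, $\hat h(v)=\overline{h(\bar v)}$. The twistor transform of $f$ is the curve $G_f:V\to\mathrm{Gr}_2(\mathbb C^4)$ sending $v$ to the graph $\{(x,\Phi_f(v)x):x\in\mathbb C^2\}$ of $\Phi_f(v)=\begin{pmatrix} g(v)&-\hat h(v)\\ h(v)&\hat g(v)\end{pmatrix}$. Let $[\zeta_1:\dots:\zeta_6]$ be the Plücker coordinates with respect to the basis $e_3\wedge e_4,\,-e_2\wedge e_4,\,e_2\wedge e_3,\,e_1\wedge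 e_4,\,-e_1\wedge e_3,\,e_1\wedge e_2$ of $\bigwedge^2\mathbb C^4$. For $[z]\in(\mathbb{CP}^5)^\vee$ the hyperplane section $X_z$ consists of the planes in $\mathrm{Gr}_2(\mathbb C^4)$ with $\sum_k z_k\zeta_k=0$. The group $\mathrm{PGL}(2,\mathbb H)$ acts on $\mathbb P(\bigwedge^2\mathbb C^4)$ through $\bigwedge^2T$, where $T\in \mathrm{GL}(2,\mathbb H)$, the group of $T\in\mathrm{GL}(4,\mathbb C)$ commuting with $\mathbf j(Z_1,Z_2,Z_3,Z_4)=(-\bar Z_2,\bar Z_1,-\bar Z_4,\bar Z_3)$. Let $\kappa[z_1:\dots:z_6]=[z_6:-z_5:z_4:z_3:-z_2:z_1]$ be the polarity map from points to hyperplanes; the orbits of hyperplanes are the images under $\kappa$ of the orbits of points. Let $A_-$ and $A_{Q\smallsetminus N}$ be the images under $\kappa$ of the orbits of $[1:0:0:0:0:-1]$ and $[-1:0:-i:i:0:1]$, and let $A_{\mathrm{nd}}$ be the image under $\kappa$ of the union over $0<\lambda<1$ of the orbits of $[-1:0:-i\lambda:i\lambda:0:1]$. For a set $A$ of hyperplanes,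 $f$ is *$A$-planar* if $G_f(V)\subseteq X_z$ for some $[z]\in A$; a *planar type* of $f$ is an orbit $A$ of hyperplanes such that $f$ is $A$-planar. **Theorem.** (i) If $r=3$, then there is exactly one $[z]\in(\mathbb{CP}^5)^\vee$ with $G_f(V)\subseteq X_z$, and it belongs to $A_-$. Hence $A_-$ is the unique planar type of $f$. (ii) If $r\le2$, then $G_f(V)$ is contained in at least two distinct hyperplane sections, and $f$ is simultaneously $A_-$-planar, $A_{Q\smallsetminus N}$-planar and $A_{\mathrm{nd}}$-planar, where $A_-$, $A_{Q\smallsetminus N}$ and $A_{\mathrm{nd}}$ are pairwise disjoint. In particular $f$ has no unique planar type. -/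

import Mathlib

open scoped Quaternion LinearAlgebra.Projectivization Matrix ComplexConjugate

noncomputable section

namespace TwistorPlanar

/-! ### The Grassmannian and its Plücker embedding -/

/-- The Grassmannian `Gr₂(ℂ⁴)`: the two-dimensional linear subspaces of `ℂ⁴`. -/
def Gr24 : Type := {L : Submodule ℂ (Fin 4 → ℂ) // Module.finrank ℂ L = 2}

/-- First indices `i` of the basis `E₁ = e₃ ∧ e₄`, `E₂ = e₄ ∧ e₂ = -e₂ ∧ e₄`, `E₃ = e₂ ∧ e₃`,
`E₄ = e₁ ∧ e₄`, `E₅ = e₃ ∧ e₁ = -e₁ ∧ e₃`, `E₆ = e₁ ∧ e₂` of `⋀² ℂ⁴`, written as `e_i ∧ e_j`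
(all indices are shifted by one, so as to start at `0`). -/
def fstIdx : Fin 6 → Fin 4 := ![2, 3, 1, 0, 2, 0]

/-- Second indices `j` of the basis vectors `E₁, …, E₆`, written as `e_i ∧ e_j`. -/
def sndIdx : Fin 6 → Fin 4 := ![3, 1, 2, 3, 0, 1]

/-- The coordinates `(ζ₁, …, ζ₆)` of `v ∧ w` with respect to the basis `E₁, …, E₆` of `⋀² ℂ⁴`. -/
def wedgeCoord (v w : Fin 4 → ℂ) : Fin 6 → ℂ :=
  fun k => v (fstIdx k) * w (sndIdx k) - v (sndIdx k) * w (fstIdx k)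

theorem wedgeCoord_ne_zero {v w : Fin 4 → ℂ} (h : LinearIndependent ℂ ![v, w]) :
    wedgeCoord v w ≠ 0 := by
  intro h0
  have hm : ∀ a b : Fin 4, v a * w b = v b * w a := by
    have e : ∀ k, v (fstIdx k) * w (sndIdx k) = v (sndIdx k) * w (fstIdx k) :=
      fun k => sub_eq_zero.mp (congrFun h0 k)
    have e0 := e 0
    have e1 := e 1
    have e2 := e 2
    have e3 := e 3
    have e4 := e 4
    have e5 := e 5
    simp [fstIdx, sndIdx] at e0 e1 e2 e3 e4 e5
    intro a b
    fin_cases a <;> fin_cases b <;> simp <;> first | assumption | (symm; assumption)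
  rw [LinearIndependent.pair_iff] at h
  by_cases hv : v = 0
  · have := h 1 0 (by simp [hv])
    simp at this
  · obtain ⟨a, ha⟩ := Function.ne_iff.mp hv
    have := h (w a) (-(v a)) (by
      funext b
      have := hm a b
      simp only [Pi.add_apply, Pi.smul_apply, smul_eq_mul, Pi.zero_apply]
      linear_combination -this)
    exact ha (by simpa using this.2)

/-- A basis of a point of the Grassmannian. -/
def Gr24.basis (L : Gr24) : Module.Basis (Fin 2) ℂ L.1 :=
  Module.finBasisOfFinrankEq ℂ L.1 L.2

theorem Gr24.linearIndependent (L : Gr24) :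
    LinearIndependent ℂ ![(L.basis 0 : Fin 4 → ℂ), (L.basis 1 : Fin 4 → ℂ)] := by
  have h := L.basis.linearIndependent.map' L.1.subtype (Submodule.ker_subtype _)
  have e : ![(L.basis 0 : Fin 4 → ℂ), (L.basis 1 : Fin 4 → ℂ)] = L.1.subtype ∘ L.basis := by
    funext i
    fin_cases i <;> rfl
  rw [e]
  exact h

/-- The Plücker embedding `Gr₂(ℂ⁴) → ℙ(⋀² ℂ⁴) = ℂP⁵`, `span {v, w} ↦ [v ∧ w]`, in the
homogeneous coordinates `[ζ₁ : … : ζ₆]`. -/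
def plucker (L : Gr24) : ℙ ℂ (Fin 6 → ℂ) :=
  Projectivization.mk ℂ (wedgeCoord (L.basis 0) (L.basis 1))
    (wedgeCoord_ne_zero L.linearIndependent)

/-- The Plücker point of a plane can be computed from any basis of it. -/
theorem plucker_eq (L : Gr24) {v w : Fin 4 → ℂ} (hv : v ∈ L.1) (hw : w ∈ L.1)
    (h : LinearIndependent ℂ ![v, w]) :
    plucker L = Projectivization.mk ℂ (wedgeCoord v w) (wedgeCoord_ne_zero h) := by
  symm
  rw [plucker, Projectivization.mk_eq_mk_iff']
  have key : ∀ u : Fin 4 → ℂ, u ∈ L.1 → ∃ c d : ℂ,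
      u = c • (L.basis 0 : Fin 4 → ℂ) + d • (L.basis 1 : Fin 4 → ℂ) := by
    intro u hu
    refine ⟨L.basis.repr ⟨u, hu⟩ 0, L.basis.repr ⟨u, hu⟩ 1, ?_⟩
    have := congrArg Subtype.val (L.basis.sum_repr ⟨u, hu⟩)
    rw [Fin.sum_univ_two] at this
    simpa using this.symm
  obtain ⟨c, d, rfl⟩ := key v hv
  obtain ⟨c', d', rfl⟩ := key w hw
  refine ⟨c * d' - d * c', ?_⟩
  funext k
  simp only [wedgeCoord, Pi.add_apply, Pi.smul_apply, smul_eq_mul]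
  ring

/-- The hyperplane section `X_z` of the Grassmannian: the planes whose Plücker coordinates satisfy
`z₁ ζ₁ + ⋯ + z₆ ζ₆ = 0`. It depends only on the class `[z] ∈ (ℂP⁵)^∨`. -/
def hyperplaneSection (z : ℙ ℂ (Fin 6 → ℂ)) : Set Gr24 :=
  {L | Projectivization.orthogonal z (plucker L)}

/-! ### The twistor transform -/

/-- The graph of the linear map `ℂ² → ℂ²` with matrix `Φ`, as a subspace of `ℂ⁴ = ℂ² ⊕ ℂ²`. -/
def graphSubmodule (Φ : Matrix (Fin 2) (Fin 2) ℂ) : Submodule ℂ (Fin 4 → ℂ) where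
  carrier := {Z | Z 2 = Φ 0 0 * Z 0 + Φ 0 1 * Z 1 ∧ Z 3 = Φ 1 0 * Z 0 + Φ 1 1 * Z 1}
  add_mem' := by
    rintro x y ⟨h1, h2⟩ ⟨h3, h4⟩
    constructor
    · simp only [Pi.add_apply, h1, h3]; ring
    · simp only [Pi.add_apply, h2, h4]; ring
  zero_mem' := by simp
  smul_mem' := by
    rintro c x ⟨h1, h2⟩
    constructor
    · simp only [Pi.smul_apply, smul_eq_mul, h1]; ring
    · simp only [Pi.smul_apply, smul_eq_mul, h2]; ring

theorem finrank_graphSubmodule (Φ : Matrix (Fin 2) (Fin 2) ℂ) :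
    Module.finrank ℂ (graphSubmodule Φ) = 2 := by
  let e : graphSubmodule Φ ≃ₗ[ℂ] (Fin 2 → ℂ) :=
    { toFun := fun Z => ![Z.1 0, Z.1 1]
      map_add' := by intro x y; ext i; fin_cases i <;> simp
      map_smul' := by intro c x; ext i; fin_cases i <;> simp
      invFun := fun x => ⟨![x 0, x 1, Φ 0 0 * x 0 + Φ 0 1 * x 1, Φ 1 0 * x 0 + Φ 1 1 * x 1], by
        constructor <;> simp⟩
      left_inv := by
        rintro ⟨Z, h1, h2⟩
        apply Subtype.ext
        funext i
        fin_cases i <;> simp [h1, h2]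
      right_inv := by intro x; ext i; fin_cases i <;> simp }
  rw [e.finrank_eq]
  simp

/-- The graph `L(Φ)` as a point of the Grassmannian. -/
def graphPoint (Φ : Matrix (Fin 2) (Fin 2) ℂ) : Gr24 := ⟨graphSubmodule Φ, finrank_graphSubmodule Φ⟩

/-- A symmetric slice domain of `ℍ`. -/
structure IsSymmetricSliceDomain (Ω : Set ℍ[ℝ]) : Prop where
  isOpen : IsOpen Ω
  isConnected : IsConnected Ω
  real_nonempty : ∃ x : ℝ, (x : ℍ[ℝ]) ∈ Ω
  slice_isOpen : ∀ I : ℍ[ℝ], I ^ 2 = -1 →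
    IsOpen {z : ℂ | (z.re : ℍ[ℝ]) + (z.im : ℍ[ℝ]) * I ∈ Ω}
  slice_isConnected : ∀ I : ℍ[ℝ], I ^ 2 = -1 →
    IsConnected {z : ℂ | (z.re : ℍ[ℝ]) + (z.im : ℍ[ℝ]) * I ∈ Ω}
  symmetric : ∀ (x y : ℝ) (I J : ℍ[ℝ]), I ^ 2 = -1 → J ^ 2 = -1 →
    (x : ℍ[ℝ]) + (y : ℍ[ℝ]) * I ∈ Ω → (x : ℍ[ℝ]) + (y : ℍ[ℝ]) * J ∈ Ω

/-- `V = Ω ∩ ℂ⁺`, where `ℂ = ℝ + iℝ ⊆ ℍ`. -/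
def upperSlice (Ω : Set ℍ[ℝ]) : Set ℂ := {v | 0 < v.im ∧ (v : ℍ[ℝ]) ∈ Ω}

/-- The first component `z` of a quaternion `q = z + w j`, with `z, w ∈ ℂ`. -/
def fstC (q : ℍ[ℝ]) : ℂ := ⟨q.re, q.imI⟩

/-- The second component `w` of a quaternion `q = z + w j`, with `z, w ∈ ℂ`. -/
def sndC (q : ℍ[ℝ]) : ℂ := ⟨q.imJ, q.imK⟩

/-- The graph matrix `Φ_f = !![g, -ĥ; h, ĝ]` of `f`, where `f = g + h j` on the slice `ℂ` and
`ĝ(z)`, `ĥ(z)` are the conjugates of `g(z̄)`, `h(z̄)`. -/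
def graphMatrix (f : ℍ[ℝ] → ℍ[ℝ]) (z : ℂ) : Matrix (Fin 2) (Fin 2) ℂ :=
  !![fstC (f (z : ℍ[ℝ])), -conj (sndC (f ((conj z : ℂ) : ℍ[ℝ])));
     sndC (f (z : ℍ[ℝ])), conj (fstC (f ((conj z : ℂ) : ℍ[ℝ])))]

/-- The twistor transform `G_f`, to be restricted to `V = Ω ∩ ℂ⁺`. -/
def twistorTransform (f : ℍ[ℝ] → ℍ[ℝ]) (v : ℂ) : Gr24 := graphPoint (graphMatrix f v)

/-- The slice-regular polynomial `f(q) = ∑ q^m a_m`. -/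
def slicePoly {n : ℕ} (a : Fin (n + 1) → ℍ[ℝ]) (q : ℍ[ℝ]) : ℍ[ℝ] :=
  ∑ m : Fin (n + 1), q ^ (m : ℕ) * a m

/-- The real span `S_f` of the non-constant coefficients `a₁, …, a_n`. -/
def coeffSpan {n : ℕ} (a : Fin (n + 1) → ℍ[ℝ]) : Submodule ℝ ℍ[ℝ] :=
  Submodule.span ℝ (Set.range fun m : Fin n => a m.succ)

/-! ### The action of `PGL(2, ℍ)` and the hyperplane types -/

/-- The antilinear structure map `𝐣` of `ℂ⁴ = ℍ²`. -/
def bj (Z : Fin 4 → ℂ) : Fin 4 → ℂ := ![-conj (Z 1), conj (Z 0), -conj (Z 3), conj (Z 2)]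

/-- `GL(2, ℍ)` as the subgroup of `GL(4, ℂ)` of the automorphisms of `ℂ⁴` commuting with `𝐣`. -/
def GL2H : Subgroup (GL (Fin 4) ℂ) where
  carrier := {T | ∀ Z, T.1 *ᵥ bj Z = bj (T.1 *ᵥ Z)}
  mul_mem' := by
    intro S T hS hT Z
    simp only [Units.val_mul, ← Matrix.mulVec_mulVec]
    rw [hT, hS]
  one_mem' := by intro Z; simp
  inv_mem' := by
    intro T hT Z
    have h := hT ((T⁻¹).1 *ᵥ Z)
    have h1 : T.1 *ᵥ ((T⁻¹).1 *ᵥ Z) = Z := by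
      rw [Matrix.mulVec_mulVec, Units.mul_inv, Matrix.one_mulVec]
    rw [h1] at h
    rw [← h, Matrix.mulVec_mulVec, Units.inv_mul, Matrix.one_mulVec]

/-- The matrix of `⋀² T` with respect to the basis `E₁, …, E₆` of `⋀² ℂ⁴`. -/
def wedgeMatrix (T : Matrix (Fin 4) (Fin 4) ℂ) : Matrix (Fin 6) (Fin 6) ℂ :=
  Matrix.of fun k l =>
    wedgeCoord (fun a => T a (fstIdx l)) (fun a => T a (sndIdx l)) k

theorem wedgeMatrix_mulVec (T : Matrix (Fin 4) (Fin 4) ℂ) (v w : Fin 4 → ℂ) :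
    wedgeMatrix T *ᵥ wedgeCoord v w = wedgeCoord (T *ᵥ v) (T *ᵥ w) := by
  funext k
  simp only [wedgeMatrix, wedgeCoord, Matrix.mulVec, dotProduct, Matrix.of_apply,
    Fin.sum_univ_six, Fin.sum_univ_four]
  simp only [fstIdx, sndIdx, Matrix.cons_val]
  ring

theorem wedgeMatrix_mul (S T : Matrix (Fin 4) (Fin 4) ℂ) :
    wedgeMatrix (S * T) = wedgeMatrix S * wedgeMatrix T := by
  ext k l
  have h := congrFun (wedgeMatrix_mulVec S (fun a => T a (fstIdx l)) (fun a => T a (sndIdx l))) k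
  exact h.symm

theorem wedgeMatrix_one : wedgeMatrix 1 = 1 := by
  ext k l
  fin_cases k <;> fin_cases l <;>
    simp [wedgeMatrix, wedgeCoord, fstIdx, sndIdx, Matrix.one_apply]

/-- The homomorphism `T ↦ ⋀² T` from `GL(4, ℂ)` to `GL(⋀² ℂ⁴)`. -/
def wedgeGL : GL (Fin 4) ℂ →* LinearMap.GeneralLinearGroup ℂ (Fin 6 → ℂ) :=
  (Matrix.GeneralLinearGroup.toLin (n := Fin 6) (R := ℂ)).toMonoidHom.comp
    (Units.map
      { toFun := wedgeMatrix
        map_one' := wedgeMatrix_one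
        map_mul' := wedgeMatrix_mul })

/-- The orbit of a point of `ℙ(⋀² ℂ⁴)` under the projective action of `PGL(2, ℍ)`. As real scalars
act trivially, it is the orbit under the image of `GL(2, ℍ)`. -/
def poleOrbit (p : ℙ ℂ (Fin 6 → ℂ)) : Set (ℙ ℂ (Fin 6 → ℂ)) :=
  MulAction.orbit (GL2H.map wedgeGL) p

/-- The linear map underlying the polarity map. -/
def kappaLin : (Fin 6 → ℂ) →ₗ[ℂ] (Fin 6 → ℂ) where
  toFun z := ![z 5, -z 4, z 3, z 2, -z 1, z 0]
  map_add' := by intro x y; ext i; fin_cases i <;> simp <;> ring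
  map_smul' := by intro c x; ext i; fin_cases i <;> simp

theorem kappaLin_injective : Function.Injective kappaLin := by
  have h : Function.LeftInverse kappaLin kappaLin := by
    intro x; ext i; fin_cases i <;> simp [kappaLin]
  exact h.injective

/-- The polarity map `κ : ℂP⁵ → (ℂP⁵)^∨` of the Klein quadric, which takes a pole to its polar
hyperplane. -/
def kappa : ℙ ℂ (Fin 6 → ℂ) → ℙ ℂ (Fin 6 → ℂ) :=
  Projectivization.map kappaLin kappaLin_injective

/-- The `PGL(2, ℍ)`-orbits of hyperplanes: the polars of the `PGL(2, ℍ)`-orbits of poles. -/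
def IsHyperplaneOrbit (A : Set (ℙ ℂ (Fin 6 → ℂ))) : Prop := ∃ p, A = kappa '' poleOrbit p

/-- The real space-like pole `[1 : 0 : 0 : 0 : 0 : -1]`. -/
def poleMinus : ℙ ℂ (Fin 6 → ℂ) :=
  Projectivization.mk ℂ ![1, 0, 0, 0, 0, -1] (fun h => by simpa using congrFun h 0)

/-- The non-real isotropic pole `[-1 : 0 : -i : i : 0 : 1]`. -/
def poleQN : ℙ ℂ (Fin 6 → ℂ) :=
  Projectivization.mk ℂ ![-1, 0, -Complex.I, Complex.I, 0, 1] (fun h => by simpa using congrFun h 0)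

/-- The non-real negative-definite poles `[-1 : 0 : -iλ : iλ : 0 : 1]`, for `0 < λ < 1`. -/
def poleND (l : ℝ) : ℙ ℂ (Fin 6 → ℂ) :=
  Projectivization.mk ℂ ![-1, 0, -Complex.I * l, Complex.I * l, 0, 1]
    (fun h => by simpa using congrFun h 0)

/-- The dual real space-like orbit `A_-`. -/
def typeMinus : Set (ℙ ℂ (Fin 6 → ℂ)) := kappa '' poleOrbit poleMinus

/-- The dual `Q ∖ N`-tangent orbit `A_{Q∖N}`. -/
def typeQN : Set (ℙ ℂ (Fin 6 → ℂ)) := kappa '' poleOrbit poleQN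

/-- The dual non-real negative-definite family `A_nd`. -/
def typeND : Set (ℙ ℂ (Fin 6 → ℂ)) := kappa '' ⋃ l ∈ Set.Ioo (0 : ℝ) 1, poleOrbit (poleND l)

/-- The curve `G : V → Gr₂(ℂ⁴)` is contained in the hyperplane section `X_z`. -/
def ContainedIn (V : Set ℂ) (G : ℂ → Gr24) (z : ℙ ℂ (Fin 6 → ℂ)) : Prop :=
  G '' V ⊆ hyperplaneSection z

/-- The curve `G : V → Gr₂(ℂ⁴)` is planar of type `A`. -/
def IsPlanarOfType (V : Set ℂ) (G : ℂ → Gr24) (A : Set (ℙ ℂ (Fin 6 → ℂ))) : Prop :=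
  ∃ z ∈ A, ContainedIn V G z

/-- The set of the planar types of a curve: the orbits `A` such that the curve is planar of
type `A`. -/
def planarTypes (V : Set ℂ) (G : ℂ → Gr24) : Set (Set (ℙ ℂ (Fin 6 → ℂ))) :=
  {A | IsHyperplaneOrbit A ∧ IsPlanarOfType V G A}

end TwistorPlanar

end

namespace TwistorPlanar

/-! Along the curve the equation of a hyperplane section is a polynomial identity in `v`: `ω 0 * det
Φ_f`, plus a real-linear form `L : ℍ → ℂ` with coefficients `ω 1, …, ω 4` applied to each `a m`,
plus `ω 5`. If `a_N` is the last nonzero coefficient, then `N ≥ 1` and `det Φ_f` has coefficient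
`|a_N|²` in degree `2N`, out of reach of the linear part. Hence `ω 0 = 0`, and the remaining degrees
say that `L` kills `S_f` and `ω 5 = -L(a₀)` (`containedIn_iff`). The hyperplanes through the curve
are thus the nonzero forms `ℍ / S_f → ℂ` up to scale, a projective space of dimension `3 - r`.

For `r = 3` this is one point, the real form `⟪b, ·⟫` with `b` spanning the orthogonal complement of
`S_f`. For `r ≤ 2` two orthonormal vectors of the complement give the forms `⟪b₁, ·⟫ + iλ⟪b₂, ·⟫`
for all real `λ`. A quaternionic matrix independent of `λ` carries `[-1 : 0 : -iλ : iλ : 0 : 1]` to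
the pole of this form (`exists_GL2H_pole`, `mk_zvec_mem`), so `λ = 0, 1/2, 1` realise the three
types. For `0 ≤ λ ≤ 1` two invariants separate them: the pole lies on the Plücker quadric only for
`λ = 1`, and is real only for `λ = 0` (`poleND_invariants`). -/

/-! ### Containment in a hyperplane section as linear conditions on the coefficients -/

theorem fstC_coe_mul (z : ℂ) (q : ℍ[ℝ]) : fstC ((z : ℍ[ℝ]) * q) = z * fstC q := by
  apply Complex.ext <;> simp [fstC]

theorem sndC_coe_mul (z : ℂ) (q : ℍ[ℝ]) : sndC ((z : ℍ[ℝ]) * q) = z * sndC q := by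
  apply Complex.ext <;> simp [sndC]

theorem fstC_sum {ι : Type*} (s : Finset ι) (q : ι → ℍ[ℝ]) :
    fstC (∑ i ∈ s, q i) = ∑ i ∈ s, fstC (q i) :=
  map_sum (AddMonoidHom.mk' fstC fun x y => by apply Complex.ext <;> simp [fstC]) q s

theorem sndC_sum {ι : Type*} (s : Finset ι) (q : ι → ℍ[ℝ]) :
    sndC (∑ i ∈ s, q i) = ∑ i ∈ s, sndC (q i) :=
  map_sum (AddMonoidHom.mk' sndC fun x y => by apply Complex.ext <;> simp [sndC]) q s

theorem fstC_slicePoly {n : ℕ} (a : Fin (n + 1) → ℍ[ℝ]) (v : ℂ) :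
    fstC (slicePoly a v) = ∑ m : Fin (n + 1), v ^ (m : ℕ) * fstC (a m) := by
  simp only [slicePoly, fstC_sum, ← fstC_coe_mul, ← Quaternion.coe_ofComplex, map_pow]

theorem sndC_slicePoly {n : ℕ} (a : Fin (n + 1) → ℍ[ℝ]) (v : ℂ) :
    sndC (slicePoly a v) = ∑ m : Fin (n + 1), v ^ (m : ℕ) * sndC (a m) := by
  simp only [slicePoly, sndC_sum, ← sndC_coe_mul, ← Quaternion.coe_ofComplex, map_pow]

/-- The real-linear form on `ℍ` given by the middle coordinates of a hyperplane. -/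
noncomputable def linForm (ω : Fin 6 → ℂ) : ℍ[ℝ] →ₗ[ℝ] ℂ where
  toFun q := ω 1 * sndC q - ω 2 * fstC q + ω 3 * conj (fstC q) + ω 4 * conj (sndC q)
  map_add' x y := by
    have h1 : fstC (x + y) = fstC x + fstC y := by apply Complex.ext <;> simp [fstC]
    have h2 : sndC (x + y) = sndC x + sndC y := by apply Complex.ext <;> simp [sndC]
    simp only [h1, h2, map_add]
    ring
  map_smul' c x := by
    have h1 : fstC (c • x) = c * fstC x := by apply Complex.ext <;> simp [fstC]
    have h2 : sndC (c • x) = c * sndC x := by apply Complex.ext <;> simp [sndC]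
    simp only [h1, h2, map_mul, Complex.conj_ofReal, Complex.real_smul, RingHom.id_apply]
    ring

theorem linForm_apply (ω : Fin 6 → ℂ) (q : ℍ[ℝ]) : linForm ω q =
    ω 1 * sndC q - ω 2 * fstC q + ω 3 * conj (fstC q) + ω 4 * conj (sndC q) := rfl

theorem graphPoint_mem_hyperplaneSection (Φ : Matrix (Fin 2) (Fin 2) ℂ) (ω : Fin 6 → ℂ)
    (hω : ω ≠ 0) :
    graphPoint Φ ∈ hyperplaneSection (Projectivization.mk ℂ ω hω) ↔
      ω 0 * (Φ 0 0 * Φ 1 1 - Φ 0 1 * Φ 1 0) + ω 1 * Φ 1 0 - ω 2 * Φ 0 0 + ω 3 * Φ 1 1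
        - ω 4 * Φ 0 1 + ω 5 = 0 := by
  have hv : ![1, 0, Φ 0 0, Φ 1 0] ∈ graphSubmodule Φ := by
    constructor <;> simp
  have hw : ![0, 1, Φ 0 1, Φ 1 1] ∈ graphSubmodule Φ := by
    constructor <;> simp
  have hl : LinearIndependent ℂ ![![1, 0, Φ 0 0, Φ 1 0], ![0, 1, Φ 0 1, Φ 1 1]] := by
    rw [LinearIndependent.pair_iff]
    intro s t h
    exact ⟨by simpa using congrFun h 0, by simpa using congrFun h 1⟩
  rw [hyperplaneSection, Set.mem_ofPred_eq, plucker_eq (graphPoint Φ) hv hw hl,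
    Projectivization.orthogonal_mk]
  simp only [dotProduct, Fin.sum_univ_six, wedgeCoord, fstIdx, sndIdx, Matrix.cons_val]
  constructor <;> intro h <;> linear_combination h

theorem conj_sum_pow {n : ℕ} (c : Fin (n + 1) → ℂ) (v : ℂ) :
    conj (∑ m : Fin (n + 1), (conj v) ^ (m : ℕ) * c m) = ∑ m : Fin (n + 1), v ^ (m : ℕ) * conj (c m) := by
  simp [map_sum]

theorem twistorTransform_mem_hyperplaneSection {n : ℕ} (a : Fin (n + 1) → ℍ[ℝ]) (v : ℂ)
    (ω : Fin 6 → ℂ) (hω : ω ≠ 0) :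
    twistorTransform (slicePoly a) v ∈ hyperplaneSection (Projectivization.mk ℂ ω hω) ↔
      ω 0 * ((∑ m : Fin (n + 1), v ^ (m : ℕ) * fstC (a m)) * (∑ m : Fin (n + 1), v ^ (m : ℕ) * conj (fstC (a m)))
        + (∑ m : Fin (n + 1), v ^ (m : ℕ) * sndC (a m)) * (∑ m : Fin (n + 1), v ^ (m : ℕ) * conj (sndC (a m))))
        + ∑ m : Fin (n + 1), v ^ (m : ℕ) * linForm ω (a m) + ω 5 = 0 := by
  have e : ∑ m : Fin (n + 1), v ^ (m : ℕ) * linForm ω (a m) =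
      ω 1 * (∑ m : Fin (n + 1), v ^ (m : ℕ) * sndC (a m)) - ω 2 * (∑ m : Fin (n + 1), v ^ (m : ℕ) * fstC (a m))
      + ω 3 * (∑ m : Fin (n + 1), v ^ (m : ℕ) * conj (fstC (a m)))
      + ω 4 * (∑ m : Fin (n + 1), v ^ (m : ℕ) * conj (sndC (a m))) := by
    simp only [Finset.mul_sum, ← Finset.sum_add_distrib, ← Finset.sum_sub_distrib]
    refine Finset.sum_congr rfl fun m _ => ?_
    rw [linForm_apply]
    ring
  rw [e, twistorTransform, graphPoint_mem_hyperplaneSection]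
  simp only [graphMatrix, fstC_slicePoly, sndC_slicePoly, conj_sum_pow, Matrix.of_apply,
    Matrix.cons_val]
  constructor <;> intro h <;> linear_combination h

/-- A short vertical segment above a real point of `Ω` stays in `Ω`. Infinitely many parameters are
all that is needed to pass from the curve to polynomial identities. -/
theorem upperSlice_infinite {Ω : Set ℍ[ℝ]} (hΩ : IsSymmetricSliceDomain Ω) :
    (upperSlice Ω).Infinite := by
  have hc : Continuous fun z : ℂ => (z : ℍ[ℝ]) := 
    Quaternion.ofComplex.toLinearMap.continuous_of_finiteDimensional
  obtain ⟨x, hx⟩ := hΩ.real_nonempty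
  have hU : IsOpen ((fun z : ℂ => (z : ℍ[ℝ])) ⁻¹' Ω) := hΩ.isOpen.preimage hc
  have hxU : (x : ℂ) ∈ (fun z : ℂ => (z : ℍ[ℝ])) ⁻¹' Ω := by simpa using hx
  obtain ⟨ε, hε, hb⟩ := Metric.isOpen_iff.mp hU x hxU
  refine Set.Infinite.mono (s := (fun t : ℝ => (x : ℂ) + t * Complex.I) '' Set.Ioo 0 ε) ?_ ?_
  · rintro _ ⟨t, ht, rfl⟩
    refine ⟨by simpa using ht.1, hb ?_⟩
    simpa [dist_eq_norm, abs_of_pos ht.1] using ht.2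
  · refine (Set.Ioo_infinite hε).image ?_
    intro s _ t _ h
    simpa using h

open Polynomial in
theorem containedIn_iff {Ω : Set ℍ[ℝ]} (hΩ : IsSymmetricSliceDomain Ω) {n : ℕ}
    (a : Fin (n + 1) → ℍ[ℝ]) (hf : ∃ m : Fin n, a m.succ ≠ 0) (ω : Fin 6 → ℂ) (hω : ω ≠ 0) :
    ContainedIn (upperSlice Ω) (twistorTransform (slicePoly a)) (Projectivization.mk ℂ ω hω) ↔
      ω 0 = 0 ∧ (∀ m : Fin n, linForm ω (a m.succ) = 0) ∧ linForm ω (a 0) + ω 5 = 0 := by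
  rw [ContainedIn, Set.image_subset_iff]
  constructor
  · classical
    intro h
    let P : (Fin (n + 1) → ℂ) → ℂ[X] := fun c => ∑ m : Fin (n + 1), C (c m) * X ^ (m : ℕ)
    have hP : ∀ c v, (P c).eval v = ∑ m : Fin (n + 1), v ^ (m : ℕ) * c m := by
      intro c v
      simp only [P, eval_finsetSum, eval_mul, eval_C, eval_pow, eval_X, mul_comm]
    have hPc : ∀ c (k : Fin (n + 1)), (P c).coeff k = c k := by
      intro c k
      simp only [P, finsetSum_coeff, coeff_C_mul, coeff_X_pow, Fin.val_inj]
      simp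
    have hPd : ∀ c (N : ℕ), (∀ m : Fin (n + 1), N < m → c m = 0) → (P c).natDegree ≤ N := by
      intro c N hc
      refine natDegree_sum_le_of_forall_le _ _ fun m _ => ?_
      by_cases hm : N < m
      · simp [hc m hm]
      · exact (natDegree_C_mul_X_pow_le _ _).trans (not_lt.mp hm)
    -- The equation of the section as a polynomial in `v`; it vanishes because every point of the
    -- infinite slice is a root.
    have hF : C (ω 0) * (P (fun m => fstC (a m)) * P (fun m => conj (fstC (a m)))
        + P (fun m => sndC (a m)) * P (fun m => conj (sndC (a m))))
        + P (fun m => linForm ω (a m)) + C (ω 5) = 0 := by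
      refine eq_zero_of_infinite_isRoot _ ((upperSlice_infinite hΩ).mono fun v hv => ?_)
      have := (twistorTransform_mem_hyperplaneSection a v ω hω).mp (h hv)
      simpa [IsRoot, hP] using this
    obtain ⟨m₀, hm₀⟩ := hf
    have hne : (Finset.univ.filter fun m : Fin n => a m.succ ≠ 0).Nonempty :=
      ⟨m₀, by simpa using hm₀⟩
    obtain ⟨N, hN, hmax⟩ := Finset.exists_max_image _ (fun m : Fin n => (m : ℕ)) hne
    replace hN : a N.succ ≠ 0 := by simpa using hN
    have hz : ∀ m : Fin (n + 1), ((N.succ : Fin (n + 1)) : ℕ) < m → a m = 0 := by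
      intro m hm
      obtain ⟨k, rfl⟩ := Fin.exists_succ_eq.mpr
        (show m ≠ 0 by rintro rfl; simp at hm)
      by_contra hk
      have := hmax k (by simpa using hk)
      simp at hm
      omega
    have f0 : fstC 0 = 0 := rfl
    have s0 : sndC 0 = 0 := rfl
    have h0 : ω 0 = 0 := by
      -- In degree `2N` only `det Φ_f` contributes, with `|a_N|²`; the linear part has degree at
      -- most `N`, and `N < 2N` because the index is a successor.
      have hc := congrArg (fun p : ℂ[X] => p.coeff
        (((N.succ : Fin (n + 1)) : ℕ) + ((N.succ : Fin (n + 1)) : ℕ))) hF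
      simp only [coeff_add, coeff_C_mul, coeff_zero] at hc
      rw [coeff_mul_add_eq_of_natDegree_le, coeff_mul_add_eq_of_natDegree_le,
        coeff_eq_zero_of_natDegree_lt (p := P (fun m => linForm ω (a m))), coeff_C_of_ne_zero,
        hPc, hPc, hPc, hPc] at hc
      · rw [Complex.mul_conj, Complex.mul_conj] at hc
        simp only [add_zero, mul_eq_zero] at hc
        refine hc.resolve_right fun hc => hN ?_
        rw [← Complex.ofReal_add, Complex.ofReal_eq_zero] at hc
        have h1 := Complex.normSq_nonneg (fstC (a N.succ))
        have h2 := Complex.normSq_nonneg (sndC (a N.succ))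
        have h3 : fstC (a N.succ) = 0 := Complex.normSq_eq_zero.mp (by linarith)
        have h4 : sndC (a N.succ) = 0 := Complex.normSq_eq_zero.mp (by linarith)
        simp only [fstC, sndC, Complex.ext_iff, Complex.zero_re, Complex.zero_im] at h3 h4
        exact QuaternionAlgebra.ext h3.1 h3.2 h4.1 h4.2
      · simp
      · refine (hPd _ _ ?_).trans_lt (Nat.lt_add_of_pos_left (by simp))
        intro m hm
        simp [hz m hm]
      all_goals
        refine hPd _ _ fun m hm => ?_
        simp [hz m hm, f0, s0]
    refine ⟨h0, fun m => ?_, ?_⟩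
    · have hc := congrArg (fun p : ℂ[X] => p.coeff ((m.succ : Fin (n + 1)) : ℕ)) hF
      simp only [h0, map_zero, zero_mul, zero_add, coeff_add, hPc] at hc
      rw [coeff_C_of_ne_zero (by simp)] at hc
      simpa using hc
    · have hc := congrArg (fun p : ℂ[X] => p.coeff ((0 : Fin (n + 1)) : ℕ)) hF
      simp only [h0, map_zero, zero_mul, zero_add, coeff_add, hPc] at hc
      simpa using hc
  · rintro ⟨h0, hs, h5⟩ v -
    have e : ∑ m : Fin (n + 1), v ^ (m : ℕ) * linForm ω (a m) = linForm ω (a 0) := by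
      rw [Fin.sum_univ_succ]
      simp [hs]
    rw [Set.mem_preimage, twistorTransform_mem_hyperplaneSection, e, h0, zero_mul, zero_add, h5]

/-! ### Quaternionic matrices acting on poles -/

/-- The hyperplane `⟪b, q - a⟫ = 0`. -/
noncomputable def zvec (b a : ℍ[ℝ]) : Fin 6 → ℂ :=
  ![0, conj (sndC b), -conj (fstC b), fstC b, sndC b, -((2 * inner ℝ b a : ℝ) : ℂ)]

/-- The pole of the hyperplane `⟪b, q - a⟫ = 0`. -/
noncomputable def pole (b a : ℍ[ℝ]) : Fin 6 → ℂ :=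
  ![-((2 * inner ℝ b a : ℝ) : ℂ), -sndC b, fstC b, -conj (fstC b), -conj (sndC b), 0]

theorem kappaLin_pole (b a : ℍ[ℝ]) : kappaLin (pole b a) = zvec b a := by
  ext i
  fin_cases i <;> simp [kappaLin, pole, zvec]

theorem quaternion_inner (b q : ℍ[ℝ]) :
    inner ℝ b q = b.re * q.re + b.imI * q.imI + b.imJ * q.imJ + b.imK * q.imK := by
  simp [Quaternion.inner_def]

theorem linForm_zvec (b a q : ℍ[ℝ]) : linForm (zvec b a) q = ((2 * inner ℝ b q : ℝ) : ℂ) := by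
  rw [quaternion_inner, linForm_apply]
  apply Complex.ext <;> simp [zvec, fstC, sndC] <;> ring

/-- The complex matrix of a `2 × 2` quaternionic matrix. -/
noncomputable def quatBlock (A B C D : ℍ[ℝ]) : Matrix (Fin 4) (Fin 4) ℂ :=
  !![fstC A, -conj (sndC A), fstC B, -conj (sndC B);
     sndC A, conj (fstC A), sndC B, conj (fstC B);
     fstC C, -conj (sndC C), fstC D, -conj (sndC D);
     sndC C, conj (fstC C), sndC D, conj (fstC D)]

/-- On pairs `z + wj` the map `𝐣` is left multiplication by `j`, while each block is right
multiplication by a quaternion, so the two commute. -/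
theorem quatBlock_mulVec_bj (A B C D : ℍ[ℝ]) (Z : Fin 4 → ℂ) :
    quatBlock A B C D *ᵥ bj Z = bj (quatBlock A B C D *ᵥ Z) := by
  ext i
  fin_cases i <;> simp [quatBlock, bj, Matrix.mulVec, dotProduct, Fin.sum_univ_four] <;> ring

/-- The entries multiply in reversed order because the blocks are right multiplications. -/
theorem quatBlock_mul (A B C D A' B' C' D' : ℍ[ℝ]) :
    quatBlock A B C D * quatBlock A' B' C' D' =
      quatBlock (A' * A + C' * B) (B' * A + D' * B) (A' * C + C' * D) (B' * C + D' * D) := by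
  ext i j
  fin_cases i <;> fin_cases j <;>
    simp [quatBlock, Matrix.mul_apply, Fin.sum_univ_four] <;>
    apply Complex.ext <;> simp [fstC, sndC] <;> ring

theorem quatBlock_smul_one (c : ℝ) :
    quatBlock (c : ℍ[ℝ]) 0 0 (c : ℍ[ℝ]) = (c : ℂ) • (1 : Matrix (Fin 4) (Fin 4) ℂ) := by
  have f0 : fstC 0 = 0 := rfl
  have s0 : sndC 0 = 0 := rfl
  have f1 : fstC c = c := rfl
  have s1 : sndC c = 0 := rfl
  ext i j
  fin_cases i <;> fin_cases j <;> simp [quatBlock, f0, s0, f1, s1]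

/-- The matrix sends the graph of right multiplication by `q` to that of `q + a`. -/
theorem wedgeMatrix_translate (a b : ℍ[ℝ]) :
    wedgeMatrix (quatBlock 1 0 a 1) *ᵥ pole b 0 = pole b a := by
  ext i
  simp only [Matrix.mulVec, dotProduct, Fin.sum_univ_six]
  fin_cases i <;>
    simp [wedgeMatrix, wedgeCoord, fstIdx, sndIdx, quatBlock, pole] <;>
    apply Complex.ext <;> simp [fstC, sndC, quaternion_inner] <;> ring

theorem wedgeMatrix_diag (p s b : ℍ[ℝ]) :
    wedgeMatrix (quatBlock p 0 0 s) *ᵥ pole b 0 = pole (star p * b * s) 0 := by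
  ext i
  simp only [Matrix.mulVec, dotProduct, Fin.sum_univ_six]
  fin_cases i <;>
    simp [wedgeMatrix, wedgeCoord, fstIdx, sndIdx, quatBlock, pole] <;>
    apply Complex.ext <;> simp [fstC, sndC] <;> ring

/-- The imaginary unit `i` of `ℍ`. -/
def quatI : ℍ[ℝ] := ⟨0, 1, 0, 0⟩

@[simp] theorem quatI_re : quatI.re = 0 := rfl

@[simp] theorem quatI_imI : quatI.imI = 1 := rfl

@[simp] theorem quatI_imJ : quatI.imJ = 0 := rfl

@[simp] theorem quatI_imK : quatI.imK = 0 := rfl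

/-- This pole is that of the unit sphere `|q|² = 1`; the Cayley transformation flattens it to the
hyperplane `⟪i, q⟫ = 0`. -/
theorem wedgeMatrix_cayley₁ :
    wedgeMatrix (quatBlock 1 quatI quatI 1) *ᵥ ![-1, 0, 0, 0, 0, 1] =
      (2 : ℂ) • pole (-quatI) 0 := by
  ext i
  simp only [Matrix.mulVec, dotProduct, Fin.sum_univ_six]
  fin_cases i <;>
    simp [wedgeMatrix, wedgeCoord, fstIdx, sndIdx, quatBlock, pole] <;>
    apply Complex.ext <;> simp [fstC, sndC] <;> norm_num

theorem wedgeMatrix_cayley₂ :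
    wedgeMatrix (quatBlock 1 quatI quatI 1) *ᵥ ![0, 0, -1, 1, 0, 0] =
      (2 : ℂ) • pole (-1) 0 := by
  ext i
  simp only [Matrix.mulVec, dotProduct, Fin.sum_univ_six]
  fin_cases i <;>
    simp [wedgeMatrix, wedgeCoord, fstIdx, sndIdx, quatBlock, pole] <;>
    apply Complex.ext <;> simp [fstC, sndC] <;> norm_num

theorem exists_GL2H_of_mul_eq {A B C D A' B' C' D' : ℍ[ℝ]} {c : ℝ} (hc : c ≠ 0)
    (h1 : A' * A + C' * B = c) (h2 : B' * A + D' * B = 0) (h3 : A' * C + C' * D = 0)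
    (h4 : B' * C + D' * D = c) :
    ∃ T ∈ GL2H, T.1 = quatBlock A B C D := by
  have h : quatBlock A B C D * ((c : ℂ)⁻¹ • quatBlock A' B' C' D') = 1 := by
    rw [mul_smul_comm, quatBlock_mul, h1, h2, h3, h4, quatBlock_smul_one, smul_smul,
      inv_mul_cancel₀ (by exact_mod_cast hc), one_smul]
  exact ⟨⟨quatBlock A B C D, _, h, mul_eq_one_comm.mp h⟩, quatBlock_mulVec_bj A B C D, rfl⟩

theorem exists_GL2H_translate (a : ℍ[ℝ]) : ∃ T ∈ GL2H, T.1 = quatBlock 1 0 a 1 :=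
  exists_GL2H_of_mul_eq (A' := 1) (B' := 0) (C' := -a) (D' := 1) one_ne_zero
    (by simp) (by simp) (by simp) (by simp)

theorem exists_GL2H_diag {p s : ℍ[ℝ]} (hp : p ≠ 0) (hs : s ≠ 0) :
    ∃ T ∈ GL2H, T.1 = quatBlock p 0 0 s :=
  exists_GL2H_of_mul_eq (A' := p⁻¹) (B' := 0) (C' := 0) (D' := s⁻¹) one_ne_zero
    (by simp [hp]) (by simp) (by simp) (by simp [hs])

theorem quatI_mul_quatI : quatI * quatI = -1 := by
  ext <;> simp

theorem exists_GL2H_cayley : ∃ T ∈ GL2H, T.1 = quatBlock 1 quatI quatI 1 :=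
  -- The scalar is `1 - i² = 2`.
  exists_GL2H_of_mul_eq (A' := 1) (B' := -quatI) (C' := -quatI) (D' := 1) (c := 1 + 1) (by norm_num)
    (by simp [quatI_mul_quatI]) (by simp) (by simp)
    (by simp [quatI_mul_quatI])

/-- The imaginary unit `j` of `ℍ`. -/
def quatJ : ℍ[ℝ] := ⟨0, 0, 1, 0⟩

@[simp] theorem quatJ_re : quatJ.re = 0 := rfl

@[simp] theorem quatJ_imI : quatJ.imI = 0 := rfl

@[simp] theorem quatJ_imJ : quatJ.imJ = 1 := rfl

@[simp] theorem quatJ_imK : quatJ.imK = 0 := rfl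

/-- Unit imaginary quaternions are conjugate to `i`. -/
theorem exists_mul_quatI_eq {u : ℍ[ℝ]} (hu : u * u = -1) : ∃ r : ℍ[ℝ], r ≠ 0 ∧ r * quatI = u * r := by
  by_cases h : u = -quatI
  · refine ⟨quatJ, fun h0 => ?_, ?_⟩
    · simpa using congrArg (fun q : ℍ[ℝ] => q.imJ) h0
    · rw [h]
      ext <;> simp
  -- Both `r * i` and `u * r` equal `u + i`; this `r` vanishes only for `u = -i`, where `j` serves
  -- instead.
  · refine ⟨1 - u * quatI, fun h0 => h ?_, ?_⟩
    · have : (1 - u * quatI) * quatI = 0 := by rw [h0, zero_mul]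
      rw [sub_mul, one_mul, mul_assoc, quatI_mul_quatI] at this
      exact eq_neg_of_add_eq_zero_right (by simpa using this)
    · rw [sub_mul, mul_sub, mul_assoc, quatI_mul_quatI, ← mul_assoc u u, hu]
      simp [add_comm]

/-- Orthogonality makes the real part of `b₁ * b₂⁻¹` vanish and equal norms make it a unit, so its
conjugate is both its negative and its inverse. -/
theorem mul_inv_mul_mul_inv {b₁ b₂ : ℍ[ℝ]} (h : inner ℝ b₁ b₂ = 0) (hn : ‖b₁‖ = ‖b₂‖)
    (h0 : b₁ ≠ 0) : (b₁ * b₂⁻¹) * (b₁ * b₂⁻¹) = -1 := by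
  have h2 : b₂ ≠ 0 := by
    rw [← norm_ne_zero_iff, ← hn]
    simpa using h0
  have hre : (b₁ * b₂⁻¹).re = 0 := by
    rw [Quaternion.inv_def, mul_smul_comm, Quaternion.re_smul, ← Quaternion.inner_def, h, smul_zero]
  have hs : Quaternion.normSq (b₁ * b₂⁻¹) = 1 := by
    rw [Quaternion.normSq_eq_norm_mul_self, norm_mul, norm_inv, hn,
      mul_inv_cancel₀ (by simpa using h2), one_mul]
  have hst : star (b₁ * b₂⁻¹) = -(b₁ * b₂⁻¹) := Quaternion.star_eq_neg.mpr hre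
  have := Quaternion.self_mul_star (b₁ * b₂⁻¹)
  rw [hst, hs, mul_neg] at this
  rw [← neg_eq_iff_eq_neg, this]
  rfl

theorem exists_GL2H_pole {b₁ b₂ : ℍ[ℝ]} (a : ℍ[ℝ]) (h : inner ℝ b₁ b₂ = 0) (hn : ‖b₁‖ = ‖b₂‖)
    (h0 : b₁ ≠ 0) : ∃ T ∈ GL2H,
      wedgeMatrix T.1 *ᵥ ![-1, 0, 0, 0, 0, 1] = (2 : ℂ) • pole b₁ a ∧
      wedgeMatrix T.1 *ᵥ ![0, 0, -1, 1, 0, 0] = (2 : ℂ) • pole b₂ a := by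
  have h2 : b₂ ≠ 0 := by
    rw [← norm_ne_zero_iff, ← hn]
    simpa using h0
  obtain ⟨r, hr, hru⟩ := exists_mul_quatI_eq (mul_inv_mul_mul_inv h hn h0)
  obtain ⟨T₁, hT₁, e₁⟩ := exists_GL2H_cayley
  -- After the Cayley step, `r * (-i) * s = b₁` and `r * (-1) * s = b₂` are needed. The second
  -- forces `s`, and the first becomes `r * i * r⁻¹ = b₁ * b₂⁻¹`, which is how `r` was chosen.
  obtain ⟨T₂, hT₂, e₂⟩ := exists_GL2H_diag (p := star r) (s := -(r⁻¹ * b₂))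
    (star_ne_zero.mpr hr) (neg_ne_zero.mpr (mul_ne_zero (inv_ne_zero hr) h2))
  obtain ⟨T₃, hT₃, e₃⟩ := exists_GL2H_translate a
  refine ⟨T₃ * (T₂ * T₁), mul_mem hT₃ (mul_mem hT₂ hT₁), ?_, ?_⟩
  · have : r * -quatI * -(r⁻¹ * b₂) = b₁ := by
      rw [mul_neg, mul_neg, neg_mul, neg_neg, hru, ← mul_assoc, mul_inv_cancel_right₀ hr,
        inv_mul_cancel_right₀ h2]
    rw [Units.val_mul, Units.val_mul, e₁, e₂, e₃, wedgeMatrix_mul, wedgeMatrix_mul,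
      ← Matrix.mulVec_mulVec, ← Matrix.mulVec_mulVec, wedgeMatrix_cayley₁, Matrix.mulVec_smul,
      wedgeMatrix_diag, Matrix.mulVec_smul, wedgeMatrix_translate, star_star, this]
  · have : r * -1 * -(r⁻¹ * b₂) = b₂ := by
      rw [mul_neg, mul_neg, neg_mul, neg_neg, mul_one, mul_inv_cancel_left₀ hr]
    rw [Units.val_mul, Units.val_mul, e₁, e₂, e₃, wedgeMatrix_mul, wedgeMatrix_mul,
      ← Matrix.mulVec_mulVec, ← Matrix.mulVec_mulVec, wedgeMatrix_cayley₂, Matrix.mulVec_smul,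
      wedgeMatrix_diag, Matrix.mulVec_smul, wedgeMatrix_translate, star_star, this]

/-! ### Orbit membership of explicit hyperplanes -/

theorem mem_poleOrbit_mk_iff {v w : Fin 6 → ℂ} (hv : v ≠ 0) (hw : w ≠ 0) :
    Projectivization.mk ℂ w hw ∈ poleOrbit (Projectivization.mk ℂ v hv) ↔
      ∃ T ∈ GL2H, ∃ c : ℂ, c ≠ 0 ∧ wedgeMatrix T.1 *ᵥ v = c • w := by
  constructor
  · rintro ⟨⟨_, T, hT, rfl⟩, hg⟩
    obtain ⟨c, hc⟩ := (Projectivization.mk_eq_mk_iff ℂ _ _ _ _).mp hg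
    exact ⟨T, hT, c, c.ne_zero, hc.symm⟩
  · rintro ⟨T, hT, c, hc, h⟩
    exact ⟨⟨wedgeGL T, T, hT, rfl⟩,
      (Projectivization.mk_eq_mk_iff ℂ _ _ _ _).mpr ⟨Units.mk0 c hc, h.symm⟩⟩

theorem poleND_zero : poleND 0 = poleMinus := by
  rw [poleND, poleMinus, Projectivization.mk_eq_mk_iff']
  exact ⟨-1, by ext i; fin_cases i <;> simp⟩

theorem poleND_one : poleND 1 = poleQN := by
  rw [poleND, poleQN, Projectivization.mk_eq_mk_iff']
  exact ⟨1, by ext i; fin_cases i <;> simp⟩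

theorem linForm_add_smul (ω η : Fin 6 → ℂ) (c : ℂ) (q : ℍ[ℝ]) :
    linForm (ω + c • η) q = linForm ω q + c * linForm η q := by
  simp only [linForm_apply, Pi.add_apply, Pi.smul_apply, smul_eq_mul]
  ring

theorem zvec_add_smul_ne_zero {b₁ b₂ : ℍ[ℝ]} (a : ℍ[ℝ]) (h : inner ℝ b₁ b₂ = 0) (h0 : b₁ ≠ 0)
    (c : ℂ) : zvec b₁ a + c • zvec b₂ a ≠ 0 := by
  intro hz
  -- Evaluating at `b₁` removes the `b₂` term and leaves `2‖b₁‖²`.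
  have h1 := linForm_add_smul (zvec b₁ a) (zvec b₂ a) c b₁
  rw [hz, linForm_zvec, linForm_zvec, real_inner_comm b₁ b₂, h, linForm_apply] at h1
  simp at h1
  exact h0 h1

theorem mk_zvec_mem {b₁ b₂ : ℍ[ℝ]} (a : ℍ[ℝ]) (h : inner ℝ b₁ b₂ = 0) (hn : ‖b₁‖ = ‖b₂‖)
    (h0 : b₁ ≠ 0) (l : ℝ) :
    Projectivization.mk ℂ (zvec b₁ a + (Complex.I * l) • zvec b₂ a)
      (zvec_add_smul_ne_zero a h h0 _) ∈ kappa '' poleOrbit (poleND l) := by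
  have e : kappaLin (pole b₁ a + (Complex.I * l) • pole b₂ a) =
      zvec b₁ a + (Complex.I * l) • zvec b₂ a := by
    rw [map_add, map_smul, kappaLin_pole, kappaLin_pole]
  have hne : pole b₁ a + (Complex.I * l) • pole b₂ a ≠ 0 := by
    intro hz
    rw [hz, map_zero] at e
    exact zvec_add_smul_ne_zero a h h0 _ e.symm
  refine ⟨Projectivization.mk ℂ _ hne, (mem_poleOrbit_mk_iff _ _).mpr ?_, ?_⟩
  · obtain ⟨T, hT, h1, h2⟩ := exists_GL2H_pole a h hn h0
    refine ⟨T, hT, 2, two_ne_zero, ?_⟩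
    have : (![-1, 0, -Complex.I * l, Complex.I * l, 0, 1] : Fin 6 → ℂ) =
        ![-1, 0, 0, 0, 0, 1] + (Complex.I * l) • ![0, 0, -1, 1, 0, 0] := by
      ext i
      fin_cases i <;> simp
    rw [this, Matrix.mulVec_add, Matrix.mulVec_smul, h1, h2, smul_add, smul_comm]
  · rw [kappa, Projectivization.map_mk]
    congr 1

/-! ### Invariants of the orbits -/

/-- The Plücker quadric. -/
def quadric (x : Fin 6 → ℂ) : ℂ := x 0 * x 5 - x 1 * x 4 + x 2 * x 3

/-- The real structure of `⋀² ℂ⁴` induced by `𝐣`. -/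
noncomputable def wedgeConj (x : Fin 6 → ℂ) : Fin 6 → ℂ :=
  ![conj (x 0), conj (x 4), -conj (x 3), -conj (x 2), conj (x 1), conj (x 5)]

theorem wedgeConj_smul (c : ℂ) (x : Fin 6 → ℂ) : wedgeConj (c • x) = conj c • wedgeConj x := by
  ext i
  fin_cases i <;> simp [wedgeConj]

theorem wedgeConj_wedgeCoord (v w : Fin 4 → ℂ) :
    wedgeConj (wedgeCoord v w) = wedgeCoord (bj v) (bj w) := by
  ext i
  fin_cases i <;> simp [wedgeConj, wedgeCoord, bj, fstIdx, sndIdx] <;> ring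

theorem wedgeConj_add (x y : Fin 6 → ℂ) : wedgeConj (x + y) = wedgeConj x + wedgeConj y := by
  ext i
  fin_cases i <;> simp [wedgeConj] <;> ring

theorem eq_sum_wedgeCoord (x : Fin 6 → ℂ) :
    x = ∑ k, x k • wedgeCoord (Pi.single (fstIdx k) 1) (Pi.single (sndIdx k) 1) := by
  ext i
  fin_cases i <;> simp [Fin.sum_univ_six, wedgeCoord, fstIdx, sndIdx, Pi.single_apply]

/-- On decomposable vectors `wedgeConj` is `⋀² 𝐣`, and `T` commutes with `𝐣`; the decomposable basis
vectors and antilinearity give the rest. -/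
theorem wedgeMatrix_mulVec_wedgeConj {T : GL (Fin 4) ℂ} (hT : T ∈ GL2H) (x : Fin 6 → ℂ) :
    wedgeMatrix T.1 *ᵥ wedgeConj x = wedgeConj (wedgeMatrix T.1 *ᵥ x) := by
  have hT' : ∀ Z, T.1 *ᵥ bj Z = bj (T.1 *ᵥ Z) := hT
  rw [eq_sum_wedgeCoord x]
  simp only [Fin.sum_univ_six, wedgeConj_add, Matrix.mulVec_add, wedgeConj_smul,
    Matrix.mulVec_smul, wedgeConj_wedgeCoord, wedgeMatrix_mulVec, hT']

/-- Conceptually, `x ∧ x = 2 * quadric x • e₁ ∧ e₂ ∧ e₃ ∧ e₄`, and `⋀⁴ T` is multiplication by `det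
T`. -/
theorem quadric_wedgeMatrix_mulVec (T : Matrix (Fin 4) (Fin 4) ℂ) (x : Fin 6 → ℂ) :
    quadric (wedgeMatrix T *ᵥ x) = T.det * quadric x := by
  have hdet : T.det = T 0 0 * (T 1 1 * (T 2 2 * T 3 3 - T 2 3 * T 3 2)
      - T 1 2 * (T 2 1 * T 3 3 - T 2 3 * T 3 1) + T 1 3 * (T 2 1 * T 3 2 - T 2 2 * T 3 1))
      - T 0 1 * (T 1 0 * (T 2 2 * T 3 3 - T 2 3 * T 3 2)
      - T 1 2 * (T 2 0 * T 3 3 - T 2 3 * T 3 0) + T 1 3 * (T 2 0 * T 3 2 - T 2 2 * T 3 0))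
      + T 0 2 * (T 1 0 * (T 2 1 * T 3 3 - T 2 3 * T 3 1)
      - T 1 1 * (T 2 0 * T 3 3 - T 2 3 * T 3 0) + T 1 3 * (T 2 0 * T 3 1 - T 2 1 * T 3 0))
      - T 0 3 * (T 1 0 * (T 2 1 * T 3 2 - T 2 2 * T 3 1)
      - T 1 1 * (T 2 0 * T 3 2 - T 2 2 * T 3 0) + T 1 2 * (T 2 0 * T 3 1 - T 2 1 * T 3 0)) := by
    rw [Matrix.det_succ_row_zero]
    simp [Fin.sum_univ_four, Matrix.det_fin_three, Fin.succAbove]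
    ring
  rw [hdet]
  simp only [quadric, wedgeMatrix, wedgeCoord, Matrix.mulVec, dotProduct, Matrix.of_apply,
    Fin.sum_univ_six, fstIdx, sndIdx, Matrix.cons_val]
  ring

theorem poleND_invariants {l : ℝ} {x : Fin 6 → ℂ} (hx : x ≠ 0)
    (h : Projectivization.mk ℂ x hx ∈ poleOrbit (poleND l)) :
    (quadric x = 0 ↔ l ^ 2 = 1) ∧ ((∃ c : ℂ, wedgeConj x = c • x) ↔ l = 0) := by
  obtain ⟨T, hT, c, hc, e⟩ := (mem_poleOrbit_mk_iff _ _).mp h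
  set u : Fin 6 → ℂ := ![-1, 0, -Complex.I * l, Complex.I * l, 0, 1] with hu
  have hdet : T.1.det ≠ 0 := ((Matrix.isUnit_iff_isUnit_det _).mp T.isUnit).ne_zero
  have hinj : ∀ y z, wedgeMatrix T.1 *ᵥ y = wedgeMatrix T.1 *ᵥ z → y = z := by
    intro y z hyz
    have := congrArg (fun w => wedgeMatrix (T⁻¹).1 *ᵥ w) hyz
    simpa [Matrix.mulVec_mulVec, ← wedgeMatrix_mul, wedgeMatrix_one] using this
  have hcc : conj c ≠ 0 := by simpa using hc
  constructor
  · have e1 := quadric_wedgeMatrix_mulVec T.1 u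
    have e2 : quadric (c • x) = c ^ 2 * quadric x := by
      simp [quadric]
      ring
    have e3 : quadric u = ((l ^ 2 - 1 : ℝ) : ℂ) := by
      simp [quadric, hu]
      linear_combination (-(l : ℂ) ^ 2) * Complex.I_sq
    rw [e, e2, e3] at e1
    rw [← sub_eq_zero (a := l ^ 2)]
    constructor <;> intro h0
    · rw [h0, mul_zero, eq_comm, mul_eq_zero] at e1
      exact_mod_cast e1.resolve_left hdet
    · rw [h0, Complex.ofReal_zero, mul_zero, mul_eq_zero] at e1
      exact e1.resolve_left (pow_ne_zero 2 hc)
  · have e1 : wedgeMatrix T.1 *ᵥ wedgeConj u = conj c • wedgeConj x := by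
      rw [wedgeMatrix_mulVec_wedgeConj hT, e, wedgeConj_smul]
    constructor
    · rintro ⟨d, hd⟩
      have e2 : wedgeConj u = (conj c * d * c⁻¹) • u := by
        apply hinj
        rw [e1, Matrix.mulVec_smul, e, hd, smul_smul, smul_smul, mul_assoc _ c⁻¹,
          inv_mul_cancel₀ hc, mul_one]
      -- The last coordinate forces the scalar to be `1`; the coordinate at index `3` then reads
      -- `-iλ = iλ`.
      have h5 := congrFun e2 5
      have h3 := congrFun e2 3
      simp [wedgeConj, hu] at h5 h3
      rw [← h5] at h3
      have : (2 * Complex.I) * (l : ℂ) = 0 := by linear_combination -h3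
      simpa using this
    · rintro rfl
      refine ⟨(conj c)⁻¹ * c, ?_⟩
      have e2 : wedgeConj u = u := by
        ext i
        fin_cases i <;> simp [wedgeConj, hu]
      rw [e2, e] at e1
      rw [mul_smul, e1, smul_smul, inv_mul_cancel₀ hcc, one_smul]

theorem kappa_injective : Function.Injective kappa :=
  Projectivization.map_injective _ kappaLin_injective

theorem disjoint_kappa_image_poleOrbit {l m : ℝ} (hl : 0 ≤ l) (hm : 0 ≤ m)
    (h : ¬ ((l = 1 ↔ m = 1) ∧ (l = 0 ↔ m = 0))) :
    Disjoint (kappa '' poleOrbit (poleND l)) (kappa '' poleOrbit (poleND m)) := by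
  rw [Set.disjoint_image_iff kappa_injective, Set.disjoint_left]
  intro p hp hq
  induction p using Projectivization.ind with
  | h x hx =>
    obtain ⟨h1, h2⟩ := poleND_invariants hx hp
    obtain ⟨h3, h4⟩ := poleND_invariants hx hq
    rw [pow_eq_one_iff_of_nonneg hl two_ne_zero] at h1
    rw [pow_eq_one_iff_of_nonneg hm two_ne_zero] at h3
    exact h ⟨h1.symm.trans h3, h2.symm.trans h4⟩

theorem typeMinus_eq : typeMinus = kappa '' poleOrbit (poleND 0) := by
  rw [poleND_zero, typeMinus]

theorem typeQN_eq : typeQN = kappa '' poleOrbit (poleND 1) := by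
  rw [poleND_one, typeQN]

theorem typeND_eq : typeND = ⋃ l ∈ Set.Ioo (0 : ℝ) 1, kappa '' poleOrbit (poleND l) := by
  rw [typeND, Set.image_iUnion₂]

theorem disjoint_typeMinus_typeQN : Disjoint typeMinus typeQN := by
  rw [typeMinus_eq, typeQN_eq]
  exact disjoint_kappa_image_poleOrbit le_rfl zero_le_one (by simp)

theorem disjoint_typeMinus_typeND : Disjoint typeMinus typeND := by
  simp only [typeMinus_eq, typeND_eq, Set.disjoint_iUnion_right]
  intro l hl
  exact disjoint_kappa_image_poleOrbit le_rfl hl.1.le (by simp [hl.1.ne'])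

theorem disjoint_typeQN_typeND : Disjoint typeQN typeND := by
  simp only [typeQN_eq, typeND_eq, Set.disjoint_iUnion_right]
  intro l hl
  exact disjoint_kappa_image_poleOrbit zero_le_one hl.1.le (by simp [hl.2.ne])

theorem IsHyperplaneOrbit.eq_of_mem {A B : Set (ℙ ℂ (Fin 6 → ℂ))} (hA : IsHyperplaneOrbit A)
    (hB : IsHyperplaneOrbit B) {z : ℙ ℂ (Fin 6 → ℂ)} (hzA : z ∈ A) (hzB : z ∈ B) : A = B := by
  obtain ⟨p, rfl⟩ := hA
  obtain ⟨q, rfl⟩ := hB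
  obtain ⟨x, hx, rfl⟩ := hzA
  obtain ⟨y, hy, hxy⟩ := hzB
  rw [kappa_injective hxy] at hy
  rw [poleOrbit, poleOrbit, ← MulAction.orbit_eq_iff.mpr hx, ← MulAction.orbit_eq_iff.mpr hy]

/-! ### Hyperplanes through the curve from the orthogonal complement of the coefficient span -/

theorem linForm_add_apply_five_zvec (b₁ b₂ q : ℍ[ℝ]) (c : ℂ) :
    linForm (zvec b₁ q + c • zvec b₂ q) q + (zvec b₁ q + c • zvec b₂ q) 5 = 0 := by
  rw [linForm_add_smul, linForm_zvec, linForm_zvec]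
  simp [zvec]
  ring

theorem containedIn_mk_zvec {Ω : Set ℍ[ℝ]} (hΩ : IsSymmetricSliceDomain Ω) {n : ℕ}
    {a : Fin (n + 1) → ℍ[ℝ]} (hf : ∃ m : Fin n, a m.succ ≠ 0) {b₁ b₂ : ℍ[ℝ]}
    (h₁ : b₁ ∈ (coeffSpan a)ᗮ) (h₂ : b₂ ∈ (coeffSpan a)ᗮ) {c : ℂ}
    (h : zvec b₁ (a 0) + c • zvec b₂ (a 0) ≠ 0) :
    ContainedIn (upperSlice Ω) (twistorTransform (slicePoly a)) (Projectivization.mk ℂ _ h) := by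
  refine (containedIn_iff hΩ a hf _ _).mpr ⟨by simp [zvec], fun m => ?_,
    linForm_add_apply_five_zvec _ _ _ _⟩
  have hm : a m.succ ∈ coeffSpan a := Submodule.subset_span ⟨m, rfl⟩
  rw [linForm_add_smul, linForm_zvec, linForm_zvec, real_inner_comm, real_inner_comm _ b₂,
    (Submodule.mem_orthogonal _ _).mp h₁ _ hm, (Submodule.mem_orthogonal _ _).mp h₂ _ hm]
  simp

theorem isPlanarOfType_kappa_image {Ω : Set ℍ[ℝ]} (hΩ : IsSymmetricSliceDomain Ω) {n : ℕ}
    {a : Fin (n + 1) → ℍ[ℝ]} (hf : ∃ m : Fin n, a m.succ ≠ 0) {b₁ b₂ : ℍ[ℝ]}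
    (h₁ : b₁ ∈ (coeffSpan a)ᗮ) (h₂ : b₂ ∈ (coeffSpan a)ᗮ) (h : inner ℝ b₁ b₂ = 0)
    (hn : ‖b₁‖ = ‖b₂‖) (h0 : b₁ ≠ 0) (l : ℝ) :
    IsPlanarOfType (upperSlice Ω) (twistorTransform (slicePoly a))
      (kappa '' poleOrbit (poleND l)) :=
  ⟨_, mk_zvec_mem (a 0) h hn h0 l, containedIn_mk_zvec hΩ hf h₁ h₂ _⟩

theorem zvec_ne_zero {b : ℍ[ℝ]} (hb : b ≠ 0) (a : ℍ[ℝ]) : zvec b a ≠ 0 := by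
  have := zvec_add_smul_ne_zero (b₂ := 0) a (inner_zero_right b) hb 0
  rwa [zero_smul, add_zero] at this

theorem mk_zvec_mem_typeMinus {b : ℍ[ℝ]} (hb : b ≠ 0) (a : ℍ[ℝ]) :
    Projectivization.mk ℂ (zvec b a) (zvec_ne_zero hb a) ∈ typeMinus := by
  -- `b * i` supplies the orthogonal partner of equal norm that `mk_zvec_mem` asks for; the
  -- parameter `0` then discards it.
  have h : inner ℝ b (b * quatI) = 0 := by
    rw [quaternion_inner]
    simp
    ring
  have hI : ‖quatI‖ = 1 := by
    rw [← pow_eq_one_iff_of_nonneg (norm_nonneg _) two_ne_zero, ← norm_pow, sq, quatI_mul_quatI]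
    simp
  have := mk_zvec_mem a h (by rw [norm_mul, hI, mul_one]) hb 0
  rw [typeMinus_eq]
  simpa using this

theorem containedIn_mk_zvec_single {Ω : Set ℍ[ℝ]} (hΩ : IsSymmetricSliceDomain Ω) {n : ℕ}
    {a : Fin (n + 1) → ℍ[ℝ]} (hf : ∃ m : Fin n, a m.succ ≠ 0) {b : ℍ[ℝ]}
    (h : b ∈ (coeffSpan a)ᗮ) (hb : b ≠ 0) :
    ContainedIn (upperSlice Ω) (twistorTransform (slicePoly a))
      (Projectivization.mk ℂ _ (zvec_ne_zero hb (a 0))) := by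
  have hne : zvec b (a 0) + (0 : ℂ) • zvec b (a 0) ≠ 0 := by simpa using zvec_ne_zero hb (a 0)
  simpa using containedIn_mk_zvec hΩ hf h h hne

theorem hyperplaneSection_zvec_ne {b₁ b₂ : ℍ[ℝ]} (a : ℍ[ℝ]) (h : inner ℝ b₁ b₂ = 0)
    (h₁ : b₁ ≠ 0) (h₂ : b₂ ≠ 0) :
    hyperplaneSection (Projectivization.mk ℂ _ (zvec_ne_zero h₁ a)) ≠
      hyperplaneSection (Projectivization.mk ℂ _ (zvec_ne_zero h₂ a)) := by
  -- The separating plane is the graph of the constant `a + b₂`, for which the equation becomes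
  -- `2⟪b, b₂⟫ = 0`.
  have key : ∀ b (hb : b ≠ 0), twistorTransform (slicePoly (n := 0) fun _ => a + b₂) 0 ∈
      hyperplaneSection (Projectivization.mk ℂ _ (zvec_ne_zero hb a)) ↔ inner ℝ b b₂ = 0 := by
    intro b hb
    have h0 : zvec b a 0 = 0 := rfl
    have h5 : zvec b a 5 = -((2 * inner ℝ b a : ℝ) : ℂ) := rfl
    rw [twistorTransform_mem_hyperplaneSection, h0, h5]
    simp only [linForm_zvec, inner_add_right]
    norm_num
    rw [mul_add, add_neg_eq_zero, add_eq_left]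
    simp
  intro he
  have := (key b₁ h₁).mpr h
  rw [he, key b₂ h₂, inner_self_eq_zero] at this
  exact h₂ this

/-- The values of the form at `1, i, j, ij` determine `ω 1, …, ω 4`, and the condition at `a`
determines `ω 5`. -/
theorem eq_smul_zvec {ω : Fin 6 → ℂ} {b a : ℍ[ℝ]} (h0 : ω 0 = 0) (h5 : linForm ω a + ω 5 = 0)
    {c : ℂ} (h : ∀ q, linForm ω q = c * linForm (zvec b a) q) : ω = c • zvec b a := by
  have e0 := h 1
  have e1 := h quatI
  have e2 := h quatJ
  have e3 := h (quatI * quatJ)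
  have f0 : fstC 1 = 1 := rfl
  have f1 : fstC quatI = Complex.I := rfl
  have f2 : fstC quatJ = 0 := rfl
  have f3 : fstC (quatI * quatJ) = 0 := by apply Complex.ext <;> simp [fstC]
  have s0 : sndC 1 = 0 := rfl
  have s1 : sndC quatI = 0 := rfl
  have s2 : sndC quatJ = 1 := rfl
  have s3 : sndC (quatI * quatJ) = Complex.I := by apply Complex.ext <;> simp [sndC]
  have e5 := linForm_add_apply_five_zvec b 0 a 0
  rw [zero_smul, add_zero] at e5
  have z0 : zvec b a 0 = 0 := rfl
  rw [h a] at h5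
  simp only [linForm_apply, f0, f1, f2, f3, s0, s1, s2, s3, map_zero, map_one, Complex.conj_I,
    mul_zero, mul_one, add_zero, sub_zero, zero_sub] at e0 e1 e2 e3
  ext i
  simp only [Pi.smul_apply, smul_eq_mul]
  fin_cases i
  · simp [h0, z0]
  · simp only [Fin.mk_one]
    linear_combination (1 / 2 : ℂ) * e2 - Complex.I / 2 * e3 +
      (ω 1 - ω 4 - c * zvec b a 1 + c * zvec b a 4) / 2 * Complex.I_sq
  · simp only [Fin.reduceFinMk]
    linear_combination (-1 / 2 : ℂ) * e0 + Complex.I / 2 * e1 +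
      (ω 2 + ω 3 - c * zvec b a 2 - c * zvec b a 3) / 2 * Complex.I_sq
  · simp only [Fin.reduceFinMk]
    linear_combination (1 / 2 : ℂ) * e0 + Complex.I / 2 * e1 +
      (ω 2 + ω 3 - c * zvec b a 2 - c * zvec b a 3) / 2 * Complex.I_sq
  · simp only [Fin.reduceFinMk]
    linear_combination (1 / 2 : ℂ) * e2 + Complex.I / 2 * e3 +
      (ω 4 - ω 1 + c * zvec b a 1 - c * zvec b a 4) / 2 * Complex.I_sq
  · simp only [Fin.reduceFinMk]
    linear_combination h5 - c * e5

theorem containedIn_iff_eq_of_finrank_eq_three {Ω : Set ℍ[ℝ]} (hΩ : IsSymmetricSliceDomain Ω)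
    {n : ℕ} {a : Fin (n + 1) → ℍ[ℝ]} (hf : ∃ m : Fin n, a m.succ ≠ 0)
    (hr : Module.finrank ℝ (coeffSpan a) = 3) :
    ∃ z ∈ typeMinus, ∀ w,
      ContainedIn (upperSlice Ω) (twistorTransform (slicePoly a)) w ↔ w = z := by
  have hd : Module.finrank ℝ (coeffSpan a)ᗮ = 1 := by
    have := (coeffSpan a).finrank_add_finrank_orthogonal
    rw [hr, Quaternion.finrank_eq_four] at this
    omega
  obtain ⟨⟨b, hbS⟩, hb0, hb⟩ := finrank_eq_one_iff'.mp hd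
  replace hb0 : b ≠ 0 := fun h => hb0 (by simp [h])
  have hbb : (inner ℝ b b : ℝ) ≠ 0 := by simpa using hb0
  refine ⟨_, mk_zvec_mem_typeMinus hb0 (a 0), fun w =>
    ⟨fun hw => ?_, fun hw => hw ▸ containedIn_mk_zvec_single hΩ hf hbS hb0⟩⟩
  induction w using Projectivization.ind with
  | h ω hω =>
    obtain ⟨h0, hs, h5⟩ := (containedIn_iff hΩ a hf ω hω).mp hw
    have hS : ∀ q ∈ coeffSpan a, linForm ω q = 0 := by
      intro q hq
      have : coeffSpan a ≤ LinearMap.ker (linForm ω) := by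
        rw [coeffSpan, Submodule.span_le]
        rintro _ ⟨m, rfl⟩
        exact hs m
      exact this hq
    -- Only the component of `q` along `b` survives, since the rest lies in the double orthogonal
    -- complement of the span, which is the span itself.
    have hq : ∀ q, linForm ω q =
        (linForm ω b / (2 * inner ℝ b b : ℝ)) * linForm (zvec b (a 0)) q := by
      intro q
      have hmem : q - (inner ℝ b q / inner ℝ b b : ℝ) • b ∈ coeffSpan a := by
        rw [← (coeffSpan a).orthogonal_orthogonal, Submodule.mem_orthogonal]
        intro u hu
        obtain ⟨t, ht⟩ := hb ⟨u, hu⟩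
        obtain rfl : t • b = u := congrArg Subtype.val ht
        rw [inner_sub_right, inner_smul_right, real_inner_smul_left, real_inner_smul_left]
        field_simp
        ring
      have := hS _ hmem
      rw [map_sub, map_smul, sub_eq_zero] at this
      rw [this, linForm_zvec, Complex.real_smul]
      have hbb' : ((inner ℝ b b : ℝ) : ℂ) ≠ 0 := by exact_mod_cast hbb
      push_cast
      field_simp
    rw [Projectivization.mk_eq_mk_iff']
    exact ⟨_, (eq_smul_zvec h0 h5 hq).symm⟩

theorem exists_orthonormal_pair_of_finrank_le_two {S : Submodule ℝ ℍ[ℝ]}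
    (hS : Module.finrank ℝ S ≤ 2) :
    ∃ b₁ ∈ Sᗮ, ∃ b₂ ∈ Sᗮ, inner ℝ b₁ b₂ = 0 ∧ ‖b₁‖ = 1 ∧ ‖b₂‖ = 1 := by
  have hd : 2 ≤ Module.finrank ℝ Sᗮ := by
    have := S.finrank_add_finrank_orthogonal
    rw [Quaternion.finrank_eq_four] at this
    omega
  let e := stdOrthonormalBasis ℝ Sᗮ
  let i : Fin (Module.finrank ℝ Sᗮ) := ⟨0, by omega⟩
  let j : Fin (Module.finrank ℝ Sᗮ) := ⟨1, by omega⟩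
  exact ⟨e i, (e i).2, e j, (e j).2, e.orthonormal.2 (by simp [i, j]), e.orthonormal.1 i,
    e.orthonormal.1 j⟩

end TwistorPlanar

open TwistorPlanar in
theorem theorem4 (Ω : Set ℍ[ℝ]) (hΩ : IsSymmetricSliceDomain Ω)
    (n : ℕ) (a : Fin (n + 1) → ℍ[ℝ]) (hf : ∃ m : Fin n, a m.succ ≠ 0) :
    (Module.finrank ℝ (coeffSpan a) = 3 →
      (∃ z ∈ typeMinus, ∀ w,
        ContainedIn (upperSlice Ω) (twistorTransform (slicePoly a)) w ↔ w = z) ∧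
      planarTypes (upperSlice Ω) (twistorTransform (slicePoly a)) = {typeMinus}) ∧
    (Module.finrank ℝ (coeffSpan a) ≤ 2 →
      (∃ z w, hyperplaneSection z ≠ hyperplaneSection w ∧
        ContainedIn (upperSlice Ω) (twistorTransform (slicePoly a)) z ∧
        ContainedIn (upperSlice Ω) (twistorTransform (slicePoly a)) w) ∧
      IsPlanarOfType (upperSlice Ω) (twistorTransform (slicePoly a)) typeMinus ∧
      IsPlanarOfType (upperSlice Ω) (twistorTransform (slicePoly a)) typeQN ∧
      IsPlanarOfType (upperSlice Ω) (twistorTransform (slicePoly a)) typeND ∧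
      Disjoint typeMinus typeQN ∧ Disjoint typeMinus typeND ∧ Disjoint typeQN typeND ∧
      ¬ ∃ A, planarTypes (upperSlice Ω) (twistorTransform (slicePoly a)) = {A}) := by
  refine ⟨fun hr => ?_, fun hr => ?_⟩
  · obtain ⟨z, hz, h⟩ := containedIn_iff_eq_of_finrank_eq_three hΩ hf hr
    refine ⟨⟨z, hz, h⟩, Set.eq_singleton_iff_unique_mem.mpr
      ⟨⟨⟨poleMinus, rfl⟩, z, hz, (h z).mpr rfl⟩, ?_⟩⟩
    rintro A ⟨hA, w, hw, hwc⟩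
    obtain rfl := (h w).mp hwc
    -- Two orbits that share the unique hyperplane coincide.
    exact hA.eq_of_mem ⟨poleMinus, rfl⟩ hw hz
  · obtain ⟨b₁, h₁, b₂, h₂, h, n₁, n₂⟩ := exists_orthonormal_pair_of_finrank_le_two hr
    have h₁0 : b₁ ≠ 0 := norm_ne_zero_iff.mp (by rw [n₁]; exact one_ne_zero)
    have h₂0 : b₂ ≠ 0 := norm_ne_zero_iff.mp (by rw [n₂]; exact one_ne_zero)
    have hp := isPlanarOfType_kappa_image hΩ hf h₁ h₂ h (n₁.trans n₂.symm) h₁0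
    have hM : IsPlanarOfType (upperSlice Ω) (twistorTransform (slicePoly a)) typeMinus :=
      typeMinus_eq ▸ hp 0
    have hQ : IsPlanarOfType (upperSlice Ω) (twistorTransform (slicePoly a)) typeQN :=
      typeQN_eq ▸ hp 1
    refine ⟨⟨_, _, hyperplaneSection_zvec_ne (a 0) h h₁0 h₂0,
      containedIn_mk_zvec_single hΩ hf h₁ h₁0, containedIn_mk_zvec_single hΩ hf h₂ h₂0⟩,
      hM, hQ, ?_, disjoint_typeMinus_typeQN, disjoint_typeMinus_typeND, disjoint_typeQN_typeND, ?_⟩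
    · obtain ⟨z, hz, hzc⟩ := hp (1 / 2)
      refine ⟨z, ?_, hzc⟩
      rw [typeND_eq]
      exact Set.mem_biUnion (by norm_num) hz
    · rintro ⟨A, hA⟩
      have e₁ : typeMinus = A := by
        rw [← Set.mem_singleton_iff, ← hA]
        exact ⟨⟨poleMinus, rfl⟩, hM⟩
      have e₂ : typeQN = A := by
        rw [← Set.mem_singleton_iff, ← hA]
        exact ⟨⟨poleQN, rfl⟩, hQ⟩
      obtain ⟨z, hz, -⟩ := hM
      exact Set.disjoint_left.mp disjoint_typeMinus_typeQN hz (by rwa [e₂, ← e₁])
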